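/- **Theorem (Conjunctive tripos).** A *conjunctive structure* is a complete lattice $(\mathcal A,\le)$ with a binary operation $\otimes$ and a unary operation $\neg$ such that, for all $a,a',b,b'\in\mathcal A$ and all $B\subseteq\mathcal A$: $a\le a'$ implies $\neg a'\le\neg a$; $a\le a'$ and $b\le b'$ imply $a\otimes b\le a'\otimes b'$; $a\otimes\bigvee B=\bigvee_{b\in B}(a\otimes b)$ and $(\bigvee B)\otimes a=\bigvee_{b\in B}(b\otimes a)$; $\neg\bigvee B=\bigwedge_{b\in B}\neg b$. Put $a\to b:=\neg(a\otimes\neg b)$. A *separator* is a subset $\mathcal S\subseteq\mathcal A$ that is upward closed, satisfies the rule "if $\neg(a\otimes b)\in\mathcal S$ and $a\in\mathcal S$ then $\neg b\in\mathcal S$", and contains $$\bigwedge_{a}\neg(\neg(a\otimes a)\otimes a),\quad \bigwedge_{a,b}\neg(\neg a\otimes(a\otimes b)),\quad \bigwedge_{a,b}\neg(\neg(a\otimes b)\otimes(b\otimes a)),$$ $$\bigwedge_{a,b,c}\neg(\neg(\neg a\otimes b)\otimes(\neg(c\otimes a)\otimes(c\otimes b))),\quad \bigwedge_{a,b,c}\neg(\neg(a\otimes(b\otimes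 c))\otimes((a\otimes b)\otimes c)).$$ It is *classical* if $\neg\neg a\in\mathcal S$ implies $a\in\mathcal S$. A *(classical) conjunctive algebra* is a conjunctive structure with a (classical) separator. Let $(\mathcal A,\le,\otimes,\neg,\mathcal S)$ be a classical conjunctive algebra. For a set $I$ let $\mathcal S[I]:=\{a\in\mathcal A^I:\exists s\in\mathcal S\ \forall i\in I\ \ s\le a_i\}$, and let $\mathcal A^I/\mathcal S[I]$ be the quotient of $\mathcal A^I$ by the equivalence relation of the preorder $a\vdash b:\Leftrightarrow(a_i\to b_i)_{i\in I}\in\mathcal S[I]$, ordered by $[a]\le[b]:\Leftrightarrow a\vdash b$. This is a Heyting algebra. The functor $\mathcal T:\mathbf{Set}^{op}\to\mathbf{HA}$ given by $\mathcal T(I)=\mathcal A^I/\mathcal S[I]$ and $\mathcal T(f)([(a_i)_{i\in I}])=[(a_{f(j)})_{j\in J}]$ for $f:J\to I$ is a tripos, that is, (i) for each set $I$ with diagonal $\delta_I:I\to I\times I$ there is $(=_I)\in\mathcal T(I\times I)$ such that $\top\le\mathcal T(\delta_I)(\varphi)\Leftrightarrow(=_I)\le\varphi$ for all $\varphi\in\mathcal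 T(I\times I)$; (ii) for each projection $\pi:I\times J\to I$ the map $\mathcal T(\pi)$ has a left adjoint $(\exists J)_I$ and a right adjoint $(\forall J)_I$; (iii) these adjoints are natural in $I$ (Beck–Chevalley), i.e. $\mathcal T(s)\circ(Q J)_{I'}=(Q J)_I\circ\mathcal T(s\times\mathrm{id}_J)$ for $s:I\to I'$ and $Q\in\{\exists,\forall\}$; (iv) there are a set $\mathrm{Prop}$ and a generic predicate $\mathrm{tr}\in\mathcal T(\mathrm{Prop})$: every $\varphi\in\mathcal T(I)$ is $\mathcal T(\chi)(\mathrm{tr})$ for some $\chi:I\to\mathrm{Prop}$. Moreover these data may be taken to be $$(\exists J)_I[(a_{ij})]=\Big[\Big(\bigvee_{j}a_{ij}\Big)_{i}\Big],\qquad (\forall J)_I[(a_{ij})]=\Big[\Big(\neg\bigvee_{j}\neg a_{ij}\Big)_{i}\Big],$$ $(=_I)=[e]$ with $e_{ij}=\bigwedge_{a\in\mathcal A}(a\to a)$ if $i=j$ and $e_{ij}=\top\to\bot$ if $i\ne j$, and $\mathrm{Prop}=\mathcal A$, $\mathrm{tr}=[\mathrm{id}_{\mathcal A}]$. -/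

import Mathlib

open CategoryTheory MonoidalCategory CartesianMonoidalCategory Opposite

universe u v w

/-! ### Triposes over a cartesian closed category -/

section Tripos

variable {C : Type u} [Category.{v} C] [CartesianMonoidalCategory C]

/-- `e` is the equality predicate on `X`: the value at `⊤` of the left adjoint of reindexing along
the diagonal `X ⟶ X ⊗ X`. -/
def IsEqualityPredicate (T : Cᵒᵖ ⥤ HeytAlg.{w}) (X : C) (e : T.obj (op (X ⊗ X))) : Prop :=
  ∀ φ : T.obj (op (X ⊗ X)), ⊤ ≤ T.map (lift (𝟙 X) (𝟙 X)).op φ ↔ e ≤ φ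

/-- `Ex Γ X` is left adjoint to reindexing along the projection `Γ ⊗ X ⟶ Γ`, for all `Γ`, `X`. -/
def IsExistential (T : Cᵒᵖ ⥤ HeytAlg.{w})
    (Ex : ∀ Γ X : C, T.obj (op (Γ ⊗ X)) → T.obj (op Γ)) : Prop :=
  ∀ (Γ X : C) (φ : T.obj (op (Γ ⊗ X))) (ψ : T.obj (op Γ)),
    φ ≤ T.map (fst Γ X).op ψ ↔ Ex Γ X φ ≤ ψ

/-- `All Γ X` is right adjoint to reindexing along the projection `Γ ⊗ X ⟶ Γ`, for all `Γ`, `X`. -/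
def IsUniversal (T : Cᵒᵖ ⥤ HeytAlg.{w})
    (All : ∀ Γ X : C, T.obj (op (Γ ⊗ X)) → T.obj (op Γ)) : Prop :=
  ∀ (Γ X : C) (φ : T.obj (op Γ)) (ψ : T.obj (op (Γ ⊗ X))),
    T.map (fst Γ X).op φ ≤ ψ ↔ φ ≤ All Γ X ψ

/-- The Beck-Chevalley condition: the quantifier `Q` is natural in the context. -/
def BeckChevalley (T : Cᵒᵖ ⥤ HeytAlg.{w})
    (Q : ∀ Γ X : C, T.obj (op (Γ ⊗ X)) → T.obj (op Γ)) : Prop :=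
  ∀ (Γ Γ' X : C) (s : Γ ⟶ Γ') (φ : T.obj (op (Γ' ⊗ X))),
    T.map s.op (Q Γ' X φ) = Q Γ X (T.map (s ▷ X).op φ)

/-- `tr ∈ T(P)` is a generic predicate: every predicate is a reindexing of it. -/
def IsGenericPredicate (T : Cᵒᵖ ⥤ HeytAlg.{w}) (P : C) (tr : T.obj (op P)) : Prop :=
  ∀ (Γ : C) (φ : T.obj (op Γ)), ∃ χ : Γ ⟶ P, φ = T.map χ.op tr

/-- First-order hyperdoctrines over a cartesian closed category. -/
structure IsFirstOrderHyperdoctrine [MonoidalClosed C] (T : Cᵒᵖ ⥤ HeytAlg.{w}) : Prop where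
  equality : ∀ X : C, ∃ e, IsEqualityPredicate T X e
  existential : ∃ Ex, IsExistential T Ex ∧ BeckChevalley T Ex
  universal : ∃ All, IsUniversal T All ∧ BeckChevalley T All

/-- A tripos is a first-order hyperdoctrine with a generic predicate. -/
structure IsTripos [MonoidalClosed C] (T : Cᵒᵖ ⥤ HeytAlg.{w}) : Prop
    extends IsFirstOrderHyperdoctrine T where
  generic : ∃ (P : C) (tr : T.obj (op P)), IsGenericPredicate T P tr

end Tripos

/-! ### Conjunctive structures and algebras -/

/-- A conjunctive structure: a complete lattice with a tensor and a negation. -/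
class ConjunctiveStructure (A : Type u) extends CompleteLattice A where
  tensor : A → A → A
  neg : A → A
  neg_anti : ∀ a a' : A, a ≤ a' → neg a' ≤ neg a
  tensor_mono : ∀ a a' b b' : A, a ≤ a' → b ≤ b' → tensor a b ≤ tensor a' b'
  tensor_sSup : ∀ (a : A) (B : Set A), tensor a (sSup B) = ⨆ b ∈ B, tensor a b
  sSup_tensor : ∀ (a : A) (B : Set A), tensor (sSup B) a = ⨆ b ∈ B, tensor b a
  neg_sSup : ∀ B : Set A, neg (sSup B) = ⨅ b ∈ B, neg b

infixr:70 " ⊗ᶜ " => ConjunctiveStructure.tensor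

prefix:max "∼" => ConjunctiveStructure.neg

namespace ConjunctiveStructure

variable {A : Type u} [ConjunctiveStructure A]

/-- The arrow `a → b := ¬(a ⊗ ¬b)`. -/
def arrow (a b : A) : A := ∼(a ⊗ᶜ ∼b)

variable (A)

def comb1 : A := ⨅ a : A, ∼(∼(a ⊗ᶜ a) ⊗ᶜ a)

def comb2 : A := ⨅ (a : A) (b : A), ∼(∼a ⊗ᶜ (a ⊗ᶜ b))

def comb3 : A := ⨅ (a : A) (b : A), ∼(∼(a ⊗ᶜ b) ⊗ᶜ (b ⊗ᶜ a))

def comb4 : A :=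
  ⨅ (a : A) (b : A) (c : A), ∼(∼(∼a ⊗ᶜ b) ⊗ᶜ (∼(c ⊗ᶜ a) ⊗ᶜ (c ⊗ᶜ b)))

def comb5 : A :=
  ⨅ (a : A) (b : A) (c : A), ∼(∼(a ⊗ᶜ (b ⊗ᶜ c)) ⊗ᶜ ((a ⊗ᶜ b) ⊗ᶜ c))

variable {A}

/-- The existential quantifier of a family of truth values. -/
def bigExists {I : Type v} (a : I → A) : A := ⨆ i, a i

/-- The universal quantifier of a family of truth values. -/
def bigForall {I : Type v} (a : I → A) : A := ∼(⨆ i, ∼(a i))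

open Classical in
/-- Leibniz equality on `I`: `⋀ₐ (a → a)` on the diagonal and `⊤ → ⊥` off the diagonal. -/
noncomputable def leibnizEq (I : Type v) (p : I × I) : A :=
  if p.1 = p.2 then ⨅ a : A, arrow a a else arrow (⊤ : A) ⊥

end ConjunctiveStructure

open ConjunctiveStructure

/-- A separator of a conjunctive structure `A`; a conjunctive algebra is a conjunctive structure
with a separator. -/
structure ConjunctiveSeparator (A : Type u) [ConjunctiveStructure A] where
  carrier : Set A
  upward : ∀ a b : A, a ∈ carrier → a ≤ b → b ∈ carrier
  comb1_mem : comb1 A ∈ carrier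
  comb2_mem : comb2 A ∈ carrier
  comb3_mem : comb3 A ∈ carrier
  comb4_mem : comb4 A ∈ carrier
  comb5_mem : comb5 A ∈ carrier
  deduction : ∀ a b : A, ∼(a ⊗ᶜ b) ∈ carrier → a ∈ carrier → ∼b ∈ carrier

namespace ConjunctiveSeparator

variable {A : Type u} [ConjunctiveStructure A] (S : ConjunctiveSeparator A)

/-- The separator is classical if it is closed under double negation elimination. -/
def IsClassical : Prop := ∀ a : A, ∼∼a ∈ S.carrier → a ∈ S.carrier

/-- The uniform separator `S[I]` on `A^I`. -/
def uniform (I : Type v) : Set (I → A) := {a | ∃ s ∈ S.carrier, ∀ i, s ≤ a i}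

/-- Entailment on `A^I` with respect to `S[I]`. -/
def Entails {I : Type v} (a b : I → A) : Prop := (fun i => arrow (a i) (b i)) ∈ S.uniform I

/-! The facts that make `A^I / S[I]` a Heyting algebra. -/

section Facts

variable {S} {I : Type v} {a b c d x y : I → A}

/-- The family `x` is uniformly refuted. -/
def Refuted (S : ConjunctiveSeparator A) {I : Type v} (x : I → A) : Prop :=
  (fun i => ∼(x i)) ∈ S.uniform I

theorem Refuted.mono (h : S.Refuted y) (hxy : ∀ i, x i ≤ y i) : S.Refuted x := by
  obtain ⟨s, hs, h⟩ := h
  exact ⟨s, hs, fun i => (h i).trans (neg_anti _ _ (hxy i))⟩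

theorem Refuted.mp (h : S.Refuted fun i => a i ⊗ᶜ b i) (ha : a ∈ S.uniform I) :
    S.Refuted b := by
  obtain ⟨s, hs, h⟩ := h
  obtain ⟨t, ht, ha⟩ := ha
  have key : ∼(t ⊗ᶜ sSup (Set.range b)) ∈ S.carrier := by
    refine S.upward s _ hs ?_
    rw [tensor_sSup, iSup_range, ← sSup_range, neg_sSup, iInf_range]
    exact le_iInf fun i => (h i).trans (neg_anti _ _ (tensor_mono _ _ _ _ (ha i) le_rfl))
  exact ⟨_, S.deduction _ _ key ht,
    fun i => neg_anti _ _ (le_sSup ⟨i, rfl⟩)⟩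

theorem refuted1 (a : I → A) : S.Refuted fun i => ∼(a i ⊗ᶜ a i) ⊗ᶜ a i :=
  ⟨_, S.comb1_mem, fun i => iInf_le _ (a i)⟩

theorem refuted2 (a b : I → A) : S.Refuted fun i => ∼(a i) ⊗ᶜ (a i ⊗ᶜ b i) :=
  ⟨_, S.comb2_mem, fun i => (iInf_le _ (a i)).trans (iInf_le _ (b i))⟩

theorem refuted3 (a b : I → A) : S.Refuted fun i => ∼(a i ⊗ᶜ b i) ⊗ᶜ (b i ⊗ᶜ a i) :=
  ⟨_, S.comb3_mem, fun i => (iInf_le _ (a i)).trans (iInf_le _ (b i))⟩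

theorem refuted4 (a b c : I → A) :
    S.Refuted fun i => ∼(∼(a i) ⊗ᶜ b i) ⊗ᶜ (∼(c i ⊗ᶜ a i) ⊗ᶜ (c i ⊗ᶜ b i)) :=
  ⟨_, S.comb4_mem, fun i => ((iInf_le _ (a i)).trans (iInf_le _ (b i))).trans (iInf_le _ (c i))⟩

theorem refuted5 (a b c : I → A) :
    S.Refuted fun i => ∼(a i ⊗ᶜ (b i ⊗ᶜ c i)) ⊗ᶜ ((a i ⊗ᶜ b i) ⊗ᶜ c i) :=
  ⟨_, S.comb5_mem, fun i => ((iInf_le _ (a i)).trans (iInf_le _ (b i))).trans (iInf_le _ (c i))⟩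

theorem Refuted.comm (h : S.Refuted fun i => a i ⊗ᶜ b i) : S.Refuted fun i => b i ⊗ᶜ a i :=
  (refuted3 a b).mp h

theorem Refuted.cut (h : S.Refuted fun i => ∼(a i) ⊗ᶜ b i) (h' : S.Refuted fun i => c i ⊗ᶜ a i) :
    S.Refuted fun i => c i ⊗ᶜ b i :=
  ((refuted4 a b c).mp h).mp h'

theorem Refuted.assoc (h : S.Refuted fun i => a i ⊗ᶜ (b i ⊗ᶜ c i)) :
    S.Refuted fun i => (a i ⊗ᶜ b i) ⊗ᶜ c i :=
  (refuted5 a b c).mp h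

theorem Refuted.assoc' (h : S.Refuted fun i => (a i ⊗ᶜ b i) ⊗ᶜ c i) :
    S.Refuted fun i => a i ⊗ᶜ (b i ⊗ᶜ c i) :=
  h.comm.assoc.comm.assoc.comm

theorem refuted_self (a : I → A) : S.Refuted fun i => ∼(a i) ⊗ᶜ a i :=
  (refuted1 a).cut (refuted2 a a)

theorem entails_of_le (h : ∀ i, a i ≤ b i) : S.Entails a b :=
  (refuted_self b).comm.mono fun i => tensor_mono _ _ _ _ (h i) le_rfl

theorem Entails.refl (a : I → A) : S.Entails a a := entails_of_le fun _ => le_rfl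

theorem Entails.trans (h : S.Entails a b) (h' : S.Entails b c) : S.Entails a c :=
  (Refuted.cut (Refuted.comm h) (Refuted.comm h')).comm

/-- Weakening the left part of a refuted tensor. -/
theorem Refuted.of_entails (h : S.Refuted fun i => c i ⊗ᶜ b i) (hab : S.Entails a b) :
    S.Refuted fun i => c i ⊗ᶜ a i :=
  Refuted.cut (Refuted.comm hab) h

theorem entails_dne (a : I → A) : S.Entails (fun i => ∼∼(a i)) a :=
  refuted_self fun i => ∼(a i)

theorem entails_dni (a : I → A) : S.Entails a (fun i => ∼∼(a i)) :=
  Refuted.of_entails (refuted_self a).comm (entails_dne fun i => ∼(a i))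

theorem Entails.contra (h : S.Entails a b) : S.Entails (fun i => ∼(b i)) (fun i => ∼(a i)) :=
  Refuted.of_entails (Refuted.comm h) (entails_dne a)

theorem Entails.of_contra (h : S.Entails (fun i => ∼(b i)) (fun i => ∼(a i))) : S.Entails a b :=
  ((entails_dni a).trans h.contra).trans (entails_dne b)

theorem tensor_left (a b : I → A) : S.Entails (fun i => a i ⊗ᶜ b i) a := (refuted2 a b).comm

theorem tensor_comm (a b : I → A) :
    S.Entails (fun i => a i ⊗ᶜ b i) (fun i => b i ⊗ᶜ a i) := (refuted3 b a).comm

theorem tensor_right (a b : I → A) : S.Entails (fun i => a i ⊗ᶜ b i) b :=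
  (tensor_comm a b).trans (tensor_left b a)

theorem Entails.tensor (h : S.Entails a b) (h' : S.Entails c d) :
    S.Entails (fun i => a i ⊗ᶜ c i) (fun i => b i ⊗ᶜ d i) := by
  have aux : ∀ {a b c : I → A}, S.Entails a b →
      S.Entails (fun i => c i ⊗ᶜ a i) (fun i => c i ⊗ᶜ b i) := fun {a b c} h =>
    Refuted.comm ((refuted4 b a c).mp (Refuted.comm h))
  exact ((tensor_comm a c).trans (aux h)).trans ((tensor_comm c b).trans (aux h'))

theorem entails_tensor (h : S.Entails a b) (h' : S.Entails a c) :
    S.Entails a (fun i => b i ⊗ᶜ c i) :=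
  Entails.trans (Refuted.comm (refuted1 a)) (h.tensor h')

theorem entails_arrow_iff :
    S.Entails a (fun i => arrow (b i) (c i)) ↔ S.Entails (fun i => a i ⊗ᶜ b i) c :=
  ⟨fun h => Refuted.assoc (Refuted.of_entails h (entails_dni _)),
    fun h => Refuted.of_entails (Refuted.assoc' h) (entails_dne _)⟩

theorem Entails.arrow (h : S.Entails b a) (h' : S.Entails c d) :
    S.Entails (fun i => arrow (a i) (c i)) (fun i => arrow (b i) (d i)) :=
  Entails.contra (h.tensor h'.contra)

end Facts

/-- The equivalence of `A^I` induced by the uniform separator. -/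
def setoid (I : Type v) : Setoid (I → A) where
  r a b := S.Entails a b ∧ S.Entails b a
  iseqv :=
    { refl := fun a => ⟨.refl a, .refl a⟩
      symm := fun h => ⟨h.2, h.1⟩
      trans := fun h h' => ⟨h.1.trans h'.1, h'.2.trans h.2⟩ }

/-- The quotient `A^I / S[I]`. -/
def Predicates (I : Type v) : Type (max u v) := Quotient (S.setoid I)

/-- The class `[a]` of a family `a`. -/
def cls {I : Type v} (a : I → A) : S.Predicates I := Quotient.mk (S.setoid I) a

/-- `A^I / S[I]` is a Heyting algebra: the order is entailment, `∧` is the tensor, `→` is the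
arrow, `a ∨ b` is `¬(¬a ⊗ ¬b)`, and `⊤`, `⊥` are those of `A`. -/
instance heytingAlgebra (I : Type v) : HeytingAlgebra (S.Predicates I) where
  le := Quotient.lift₂ S.Entails fun _ _ _ _ h h' => propext
    ⟨fun k => (h.2.trans k).trans h'.1, fun k => (h.1.trans k).trans h'.2⟩
  le_refl := by rintro ⟨a⟩; exact Entails.refl a
  le_trans := by rintro ⟨a⟩ ⟨b⟩ ⟨c⟩ h h'; exact Entails.trans (S := S) h h'
  le_antisymm := by rintro ⟨a⟩ ⟨b⟩ h h'; exact Quotient.sound (s := S.setoid I) ⟨h, h'⟩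
  sup := Quotient.map₂ (fun a b i => ∼(∼(a i) ⊗ᶜ ∼(b i))) fun _ _ h _ _ h' =>
    ⟨(h.1.contra.tensor h'.1.contra).contra,
      (h.2.contra.tensor h'.2.contra).contra⟩
  inf := Quotient.map₂ (fun a b i => a i ⊗ᶜ b i) fun _ _ h _ _ h' =>
    ⟨h.1.tensor h'.1, h.2.tensor h'.2⟩
  himp := Quotient.map₂ (fun a b i => arrow (a i) (b i)) fun _ _ h _ _ h' =>
    ⟨h.2.arrow h'.1, h.1.arrow h'.2⟩
  top := S.cls fun _ => ⊤
  bot := S.cls fun _ => ⊥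
  compl := Quotient.map (fun a i => arrow (a i) ⊥) fun _ _ h =>
    ⟨h.2.arrow (.refl _), h.1.arrow (.refl _)⟩
  le_sup_left := by
    rintro ⟨a⟩ ⟨b⟩
    exact (entails_dni a).trans (tensor_left (fun i => ∼(a i)) (fun i => ∼(b i))).contra
  le_sup_right := by
    rintro ⟨a⟩ ⟨b⟩
    exact (entails_dni b).trans (tensor_right (fun i => ∼(a i)) (fun i => ∼(b i))).contra
  sup_le := by
    rintro ⟨a⟩ ⟨b⟩ ⟨c⟩ h h'
    exact (Entails.contra (S := S)
      (entails_tensor (Entails.contra (S := S) h) (Entails.contra (S := S) h'))).trans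
        (entails_dne c)
  inf_le_left := by rintro ⟨a⟩ ⟨b⟩; exact tensor_left a b
  inf_le_right := by rintro ⟨a⟩ ⟨b⟩; exact tensor_right a b
  le_inf := by rintro ⟨a⟩ ⟨b⟩ ⟨c⟩ h h'; exact entails_tensor (S := S) h h'
  le_top := by rintro ⟨a⟩; exact entails_of_le (S := S) fun _ => le_top
  bot_le := by rintro ⟨a⟩; exact entails_of_le (S := S) fun _ => bot_le
  le_himp_iff := by rintro ⟨a⟩ ⟨b⟩ ⟨c⟩; exact entails_arrow_iff (S := S)
  himp_bot := by rintro ⟨a⟩; rfl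

/-- Reindexing along `f : J → I` maps `[(aᵢ)ᵢ]` to `[(a_{f j})ⱼ]`. -/
def reindex {I : Type v} {J : Type w} (f : J → I) :
    HeytingHom (S.Predicates I) (S.Predicates J) where
  toFun := Quotient.map (fun a j => a (f j)) fun _ _ h =>
    ⟨h.1.imp fun _ k => ⟨k.1, fun j => k.2 (f j)⟩, h.2.imp fun _ k => ⟨k.1, fun j => k.2 (f j)⟩⟩
  map_sup' := by rintro ⟨a⟩ ⟨b⟩; rfl
  map_inf' := by rintro ⟨a⟩ ⟨b⟩; rfl
  map_bot' := rfl
  map_himp' := by rintro ⟨a⟩ ⟨b⟩; rfl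

/-- The functor `I ↦ A^I / S[I]`, acting on functions by reindexing. -/
def predicateFunctor : (Type u)ᵒᵖ ⥤ HeytAlg.{u} where
  obj I := HeytAlg.of (S.Predicates I.unop)
  map f := HeytAlg.ofHom (S.reindex fun j => f.unop j)
  map_id I := by ext ⟨a⟩; rfl
  map_comp f g := by ext ⟨a⟩; rfl

end ConjunctiveSeparator

namespace ConjunctiveSeparator

variable {A : Type u} [ConjunctiveStructure A] {S : ConjunctiveSeparator A}

section Adjunctions

variable {I : Type v} {J : Type w}

/-! Entailment `a ⊢ b` says that a single element of the separator lies below every `∼(a i ⊗ᶜ ∼(b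
i))`. Since `⊗ᶜ` distributes over arbitrary joins and `∼` turns joins into meets, refuting a join
against a context is the same as refuting all its members with one common witness. Hence the
pointwise join is left adjoint to reindexing along a projection (`bigExists_entails_iff`), and
contraposition with double negation turns this into the right adjoint `∼⨆∼`
(`entails_bigForall_iff`). Equality needs its own argument (`leibnizEq_entails_iff`); the remaining
clauses hold already on representatives. -/

/-- A family of joins on the left of a tensor is refuted as soon as all its members are. -/
theorem refuted_iSup_tensor_iff {a : I × J → A} {b : I → A} :
    S.Refuted (fun i => (⨆ j, a (i, j)) ⊗ᶜ b i) ↔ S.Refuted (fun p => a p ⊗ᶜ b p.1) := by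
  -- This is an equality in `A`, so the same `s` witnesses both sides of the equivalence.
  have key : ∀ i, ∼((⨆ j, a (i, j)) ⊗ᶜ b i) = ⨅ j, ∼(a (i, j) ⊗ᶜ b i) := fun i => by
    rw [iSup, sSup_tensor, iSup_range, ← sSup_range, neg_sSup, iInf_range]
  constructor
  · rintro ⟨s, hs, h⟩
    exact ⟨s, hs, fun p => ((h p.1).trans_eq (key p.1)).trans (iInf_le _ p.2)⟩
  · rintro ⟨s, hs, h⟩
    exact ⟨s, hs, fun i => (le_iInf fun j => h (i, j)).trans_eq (key i).symm⟩

theorem bigExists_entails_iff {a : I × J → A} {b : I → A} :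
    S.Entails (fun i => bigExists fun j => a (i, j)) b ↔ S.Entails a (fun p => b p.1) :=
  refuted_iSup_tensor_iff

theorem entails_bigForall_iff {a : I → A} {b : I × J → A} :
    S.Entails a (fun i => bigForall fun j => b (i, j)) ↔ S.Entails (fun p => a p.1) b := by
  have key := bigExists_entails_iff (S := S) (a := fun p => ∼(b p)) (b := fun i => ∼(a i))
  constructor
  · intro h
    exact Entails.of_contra (key.1 ((entails_dni _).trans h.contra))
  · intro h
    exact (entails_dni a).trans (key.2 h.contra).contra

variable (S) in
/-- The existential quantifier along `I × J → I`. -/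
def existsAlong (I : Type v) (J : Type w) : S.Predicates (I × J) → S.Predicates I :=
  Quotient.map (fun a i => bigExists fun j => a (i, j)) fun _ _ h =>
    -- Independence of the representative is monotonicity, which follows from the adjunction by
    -- composing with its unit.
    ⟨bigExists_entails_iff.2 (h.1.trans (bigExists_entails_iff.1 (.refl _))),
      bigExists_entails_iff.2 (h.2.trans (bigExists_entails_iff.1 (.refl _)))⟩

variable (S) in
/-- The universal quantifier along `I × J → I`. -/
def forallAlong (I : Type v) (J : Type w) : S.Predicates (I × J) → S.Predicates I :=
  Quotient.map (fun a i => bigForall fun j => a (i, j)) fun _ _ h =>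
    -- Dually, compose with the counit.
    ⟨entails_bigForall_iff.2 ((entails_bigForall_iff.1 (.refl _)).trans h.1),
      entails_bigForall_iff.2 ((entails_bigForall_iff.1 (.refl _)).trans h.2)⟩

end Adjunctions

section Equality

variable {I : Type v}

theorem arrow_mono {a a' b b' : A} (ha : a' ≤ a) (hb : b ≤ b') : arrow a b ≤ arrow a' b' :=
  neg_anti _ _ (tensor_mono _ _ _ _ ha (neg_anti _ _ hb))

theorem top_mem (S : ConjunctiveSeparator A) : (⊤ : A) ∈ S.carrier :=
  S.upward _ _ S.comb1_mem le_top

/-- Reflexivity of entailment for the identity family, indexed by `A` itself, already supplies one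
witness below all `arrow a a`. -/
theorem iInf_arrow_self_mem (S : ConjunctiveSeparator A) : (⨅ a : A, arrow a a) ∈ S.carrier := by
  obtain ⟨s, hs, h⟩ := Entails.refl (S := S) (id : A → A)
  exact S.upward s _ hs (le_iInf h)

theorem mem_uniform_const {s : A} (hs : s ∈ S.carrier) : (fun _ : I => s) ∈ S.uniform I :=
  ⟨s, hs, fun _ => le_rfl⟩

/-- A family entailed by a uniformly valid one is uniformly doubly negated. -/
theorem Entails.refuted_neg {a b : I → A} (h : S.Entails a b) (ha : a ∈ S.uniform I) :
    S.Refuted fun i => ∼(b i) :=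
  Refuted.mp h ha

/-- Converse use of a doubly negated family: `comb2` at `∼(b i)` acts as weakening, so such a `b` is
entailed by anything. -/
theorem entails_of_refuted_neg {a b : I → A} (h : S.Refuted fun i => ∼(b i)) : S.Entails a b :=
  Refuted.comm ((refuted2 (fun i => ∼(b i)) a).mp h)

theorem leibnizEq_entails_iff {b : I × I → A} :
    S.Entails (leibnizEq I) b ↔ S.Entails (fun _ => ⊤) (fun i => b (i, i)) := by
  classical
  constructor
  · intro h
    -- On the diagonal `leibnizEq` is constant with value in the separator, so the restriction of
    -- `h` there makes `b (i, i)` doubly negated.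
    refine entails_of_refuted_neg (Entails.refuted_neg (a := fun i => leibnizEq I (i, i)) ?_ ?_)
    · obtain ⟨s, hs, h⟩ := h
      exact ⟨s, hs, fun i => h (i, i)⟩
    · simpa [leibnizEq] using mem_uniform_const S.iInf_arrow_self_mem
  · intro h
    obtain ⟨s, hs, h⟩ := h.refuted_neg (mem_uniform_const S.top_mem)
    -- The deduction rule only produces negations, so the bound `s` is available for `∼∼(b p)`
    -- rather than `b p`. Filling in `⊤` off the diagonal keeps `w` uniformly valid, and `leibnizEq`
    -- lies pointwise below `w → ∼∼b`: on the diagonal by an instance of `a → a`, off it by `⊤ → ⊥ ≤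
    -- ⊤ → ∼∼b`. Modus ponens and double negation elimination then give `b`.
    let w : I × I → A := fun p => if p.1 = p.2 then ∼∼(b p) else ⊤
    have hw : w ∈ S.uniform (I × I) := by
      refine ⟨s, hs, ?_⟩
      rintro ⟨i, j⟩
      by_cases hij : i = j
      · subst hij
        simpa [w] using h i
      · simp [w, hij]
    have hle : S.Entails (leibnizEq I) (fun p => arrow (w p) (∼∼(b p))) := by
      refine entails_of_le fun p => ?_
      by_cases hp : p.1 = p.2
      · simpa only [leibnizEq, w, if_pos hp] using iInf_le (fun a : A => arrow a a) (∼∼(b p))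
      · simpa only [leibnizEq, w, if_neg hp] using arrow_mono le_rfl bot_le
    have hwtrue : S.Entails (leibnizEq I) w :=
      entails_of_refuted_neg ((Entails.refl w).refuted_neg hw)
    exact ((entails_tensor (.refl _) hwtrue).trans (entails_arrow_iff.1 hle)).trans (entails_dne b)

end Equality

variable (S)

theorem isEqualityPredicate_leibnizEq (I : Type u) :
    IsEqualityPredicate S.predicateFunctor I (S.cls (leibnizEq I)) := by
  rintro ⟨b⟩
  exact leibnizEq_entails_iff.symm

theorem isExistential_existsAlong : IsExistential S.predicateFunctor S.existsAlong := by
  rintro I J ⟨a⟩ ⟨b⟩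
  exact bigExists_entails_iff.symm

theorem isUniversal_forallAlong : IsUniversal S.predicateFunctor S.forallAlong := by
  rintro I J ⟨a⟩ ⟨b⟩
  exact entails_bigForall_iff.symm

/-- The quantifiers are computed separately at each index of the context, so they commute with
substitution on the nose. -/
theorem beckChevalley_existsAlong : BeckChevalley S.predicateFunctor S.existsAlong := by
  rintro I I' J s ⟨a⟩
  rfl

theorem beckChevalley_forallAlong : BeckChevalley S.predicateFunctor S.forallAlong := by
  rintro I I' J s ⟨a⟩
  rfl

/-- A family `a : I → A` is its own classifying map. -/
theorem isGenericPredicate_id : IsGenericPredicate S.predicateFunctor A (S.cls id) := by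
  rintro I ⟨a⟩
  exact ⟨TypeCat.ofHom a, rfl⟩

theorem isTripos_predicateFunctor : IsTripos S.predicateFunctor where
  equality I := ⟨_, S.isEqualityPredicate_leibnizEq I⟩
  existential := ⟨_, S.isExistential_existsAlong, S.beckChevalley_existsAlong⟩
  universal := ⟨_, S.isUniversal_forallAlong, S.beckChevalley_forallAlong⟩
  generic := ⟨A, _, S.isGenericPredicate_id⟩

end ConjunctiveSeparator

theorem theorema {A : Type u} [ConjunctiveStructure A] (S : ConjunctiveSeparator A)
    (hS : S.IsClassical) :
    IsTripos S.predicateFunctor ∧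
    (∀ I : Type u, IsEqualityPredicate S.predicateFunctor I (S.cls (leibnizEq I))) ∧
    (∃ Ex, IsExistential S.predicateFunctor Ex ∧ BeckChevalley S.predicateFunctor Ex ∧
      ∀ (I J : Type u) (a : I × J → A),
        Ex I J (S.cls a) = S.cls fun i => bigExists fun j => a (i, j)) ∧
    (∃ All, IsUniversal S.predicateFunctor All ∧ BeckChevalley S.predicateFunctor All ∧
      ∀ (I J : Type u) (a : I × J → A),
        All I J (S.cls a) = S.cls fun i => bigForall fun j => a (i, j)) ∧
    IsGenericPredicate S.predicateFunctor A (S.cls id) := by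
  exact ⟨S.isTripos_predicateFunctor, S.isEqualityPredicate_leibnizEq,
    ⟨S.existsAlong, S.isExistential_existsAlong, S.beckChevalley_existsAlong, fun _ _ _ => rfl⟩,
    ⟨S.forallAlong, S.isUniversal_forallAlong, S.beckChevalley_forallAlong, fun _ _ _ => rfl⟩,
    S.isGenericPredicate_id⟩
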